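/- **Processes.** Fix an infinite set of names and a set of labels. Processes are $$P,Q ::= \mathsf{Nil}\mid x\langle y\rangle.P\mid x(y).P\mid P\,|\,Q\mid(\nu x)P\mid x\triangleleft\{\ell:P_\ell\}_{\ell\in L}\mid x\triangleright\{\ell:P_\ell\}_{\ell\in L},$$ with $L$ a finite non-empty set of labels; $x(y).P$ binds $y$ in $P$ and $(\nu x)P$ binds $x$ in $P$; $\mathrm{fn}$ and $\mathrm{bn}$ denote free and bound names. The structural precongruence $\Rrightarrow^*$ is the least reflexive, transitive relation closed under all process constructors such that $P|Q$ and $Q|P$, $(P|Q)|R$ and $P|(Q|R)$, $(\nu x)(\nu y)P$ and $(\nu y)(\nu x)P$ are related in both directions, $P|\mathsf{Nil}\Rrightarrow^* P$, and, if $x\notin\mathrm{fn}(S)$, $(\nu x)S\Rrightarrow^* S$ and $(\nu x)P\,|\,S\Rrightarrow^*(\nu x)(P|S)$. Reduction $\to$ is generated by the rules - $\mathsf{Com}$: $x\langle a\rangle.P\,|\,x(b).Q\to P\,|\,Q[a/b]$, where $a\notin\mathrm{bn}(Q)$ (which always holds if bound names are pairwise distinct and distinct from the free names); - $\mathsf{Choice}$: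 $x\triangleleft\{\ell:P_\ell\}_{\ell\in L}\to x\triangleleft\{k:P_k\}$ for $k\in L$; - $\mathsf{Label}$: $x\triangleleft\{k:P\}\,|\,x\triangleright\{\ell:Q_\ell\}_{\ell\in L}\to P\,|\,Q_k$ for $k\in L$; - $\mathsf{Res}$: $(\nu x)P\to(\nu x)P'$ if $P\to P'$; $\mathsf{Par}$: $P|Q\to P'|Q$ if $P\to P'$; - $\mathsf{Struc}$: $P\to Q$ if $P\Rrightarrow^* P'$, $P\ne P'$ and $P'\to Q$ by a derivation whose last rule is not $\mathsf{Struc}$. The *core-reduction* of a (derived) step is the instance of $\mathsf{Com}$, $\mathsf{Choice}$ or $\mathsf{Label}$ at the top of its derivation. **Logic.** Formulas of $\mathsf{PiL}$ over a set of variables, modulo $\alpha$-equivalence, are built from the unit $\circ$, atoms $\langle x!y\rangle$, $(x?y)$, binary $\wp,\otimes,\prec$ (par, tensor, precede), the connectives $\bigoplus_{i=1}^nA_i$, $\&_{i=1}^nA_i$ of any arity $n\ge1$, and quantifiers $\forall,\exists$, $\mathsf N$ (new), $\mathsf Y$ (ya). Negation is the de Morgan duality with $\circ^\perp=\circ$,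 $\langle x!y\rangle^\perp=(x?y)$, $(A\wp B)^\perp=A^\perp\otimes B^\perp$, $(A\prec B)^\perp=A^\perp\prec B^\perp$, and with $\bigoplus$ and $\&$, $\exists$ and $\forall$, $\mathsf N$ and $\mathsf Y$ dual; $A\multimap B:=A^\perp\wp B$. A store $\mathcal S$ is a finite set of marked variables $x^{\mathsf N}$, $x^{\mathsf Y}$ in which each variable occurs at most once; $\mathcal S,\mathcal S'$ is the union of two stores with no variable in common. Judgements $\mathcal S\vdash\Gamma$ ($\Gamma$ a finite multiset of formulas) are derived, without cut, by: - $\mathcal S\vdash\langle x!y\rangle,(x?y)$; $\ \mathcal S\vdash\circ$; - $\mathcal S\vdash\Gamma,A\wp B$ from $\mathcal S\vdash\Gamma,A,B$; - $\mathcal S_1,\mathcal S_2\vdash\Gamma,\Delta,A\otimes B$, and also $\mathcal S_1,\mathcal S_2\vdash\Gamma,\Delta,A\prec B$, from $\mathcal S_1\vdash\Gamma,A$ and $\mathcal S_2\vdash\Delta,B$; - $\mathcal S_1,\mathcal S_2\vdash\Gamma,\Delta$ from $\mathcal S_1\vdash\Gamma$ and $\mathcal S_2\vdash\Delta$; - $\mathcal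 S_1,\mathcal S_2\vdash\Gamma,\Delta,A\prec B,C\prec D$ from $\mathcal S_1\vdash\Gamma,A,C$ and $\mathcal S_2\vdash\Delta,B,D$; - $\mathcal S\vdash\Gamma,\bigoplus_iA_i$ from $\mathcal S\vdash\Gamma,A_k$ for one $k$; $\ \mathcal S\vdash\Gamma,\&_iA_i$ from $\mathcal S\vdash\Gamma,A_i$ for all $i$; - $\mathcal S\vdash\Gamma,\exists x.A$ from $\mathcal S\vdash\Gamma,A[y/x]$; $\ \mathcal S\vdash\Gamma,Qx.A$ from $\mathcal S\vdash\Gamma,A$, for $Q\in\{\forall,\mathsf N ,\mathsf Y \}$ and $x$ not free in $\Gamma$ and not in $\mathcal S$; - for $Q\in\{\mathsf N ,\mathsf Y \}$: $\mathcal S\vdash\Gamma,Qx.A$ from $\mathcal S,x^{Q}\vdash\Gamma,A$ with $x$ not free in $\Gamma$; and $\mathcal S,y^{Q}\vdash\Gamma,Q^\perp x.A$ from $\mathcal S\vdash\Gamma,A[y/x]$, where $Q^\perp$ is the dual of $Q$. Write $\vdash_{\mathsf{PiL}}A$ if $\emptyset\vdash A$ is derivable. **Translation.** Names and labels serve as variables,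 and $[\![\mathsf{Nil}]\!]=\circ$, $[\![P|Q]\!]=[\![P]\!]\wp [\![Q]\!]$, $[\![(\nu x)P]\!]=\mathsf N x.[\![P]\!]$, $[\![x\langle y\rangle.P]\!]=\langle x!y\rangle\prec[\![P]\!]$, $[\![x(y).P]\!]=\exists y.((x?y)\prec[\![P]\!])$ (if $x=y$, rename the bound $y$ first), $[\![x\triangleleft\{\ell:P_\ell\}_{\ell\in L}]\!]=\&_{\ell\in L}(\langle x!\ell\rangle\prec[\![P_\ell]\!])$, $[\![x\triangleright\{\ell:P_\ell\}_{\ell\in L}]\!]=\bigoplus_{\ell\in L}((x?\ell)\prec[\![P_\ell]\!])$. **Lemma.** Let $P,P'$ be processes. 1. If $P\Rrightarrow^*P'$, then $\vdash_{\mathsf{PiL}}[\![P']\!]\multimap[\![P]\!]$. 2. If $P\to P'$, then either (a) the core-reduction of the step is a $\mathsf{Com}$ or a $\mathsf{Label}$, and $\vdash_{\mathsf{PiL}}[\![P']\!]\multimap[\![P]\!]$; or (b) the core-reduction of the step is a $\mathsf{Choice}$, and there are a finite non-empty set $L$ of labels and processes $P_\ell$ ($\ell\in L$), one of which is $P'$,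 such that $P\to P_\ell$ for all $\ell\in L$ and $\vdash_{\mathsf{PiL}}\bigl(\&_{\ell\in L}[\![P_\ell]\!]\bigr)\multimap[\![P]\!]$. -/

import Mathlib

universe u v

namespace PiL

/-! ## Formulas of `PiL`

Formulas are taken modulo α-equivalence: free variables are elements of `V`, bound variables are
de Bruijn indices. `Form V n` is the type of formulas with `n` dangling indices; the formulas of
the logic are the elements of `Form V 0`. -/

/-- Formulas over the variables `V` with `n` dangling bound variables.
`send s t` and `recv s t` are the two dual binary atoms; `oplus` and `wth` have any positive
arity. Each quantifier binds index `0` of its body (older indices are shifted by one). -/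
inductive Form (V : Type u) : ℕ → Type u
  | unit {n : ℕ} : Form V n
  | send {n : ℕ} (s t : V ⊕ Fin n) : Form V n
  | recv {n : ℕ} (s t : V ⊕ Fin n) : Form V n
  | par {n : ℕ} (A B : Form V n) : Form V n
  | tensor {n : ℕ} (A B : Form V n) : Form V n
  | prec {n : ℕ} (A B : Form V n) : Form V n
  | oplus {n : ℕ} (k : ℕ) (hk : 0 < k) (A : Fin k → Form V n) : Form V n
  | wth {n : ℕ} (k : ℕ) (hk : 0 < k) (A : Fin k → Form V n) : Form V n
  | all {n : ℕ} (A : Form V (n + 1)) : Form V n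
  | ex {n : ℕ} (A : Form V (n + 1)) : Form V n
  | new {n : ℕ} (A : Form V (n + 1)) : Form V n
  | ya {n : ℕ} (A : Form V (n + 1)) : Form V n

namespace Form

variable {V : Type u}

/-- Negation, by de Morgan duality. -/
def neg : {n : ℕ} → Form V n → Form V n
  | _, unit => unit
  | _, send s t => recv s t
  | _, recv s t => send s t
  | _, par A B => tensor A.neg B.neg
  | _, tensor A B => par A.neg B.neg
  | _, prec A B => prec A.neg B.neg
  | _, oplus k hk A => wth k hk (fun i => (A i).neg)
  | _, wth k hk A => oplus k hk (fun i => (A i).neg)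
  | _, all A => ex A.neg
  | _, ex A => all A.neg
  | _, new A => ya A.neg
  | _, ya A => new A.neg

/-- Linear implication. -/
def limp {n : ℕ} (A B : Form V n) : Form V n := par A.neg B

/-- The free variables of a formula. -/
def fv : {n : ℕ} → Form V n → Set V
  | _, unit => ∅
  | _, send s t => {z | s = Sum.inl z ∨ t = Sum.inl z}
  | _, recv s t => {z | s = Sum.inl z ∨ t = Sum.inl z}
  | _, par A B => A.fv ∪ B.fv
  | _, tensor A B => A.fv ∪ B.fv
  | _, prec A B => A.fv ∪ B.fv
  | _, oplus _ _ A => ⋃ i, (A i).fv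
  | _, wth _ _ A => ⋃ i, (A i).fv
  | _, all A => A.fv
  | _, ex A => A.fv
  | _, new A => A.fv
  | _, ya A => A.fv

/-- A variable seen from below one more binder. -/
def shift {n : ℕ} : V ⊕ Fin n → V ⊕ Fin (n + 1)
  | Sum.inl z => Sum.inl z
  | Sum.inr i => Sum.inr i.succ

/-- Extend a renaming of variables below one more binder. -/
def lift {n m : ℕ} (f : V ⊕ Fin n → V ⊕ Fin m) : V ⊕ Fin (n + 1) → V ⊕ Fin (m + 1)
  | Sum.inl z => shift (f (Sum.inl z))
  | Sum.inr i => Fin.cases (Sum.inr 0) (fun j => shift (f (Sum.inr j))) i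

/-- Capture-free renaming of the free variables and dangling indices of a formula. -/
def rename : {n m : ℕ} → (V ⊕ Fin n → V ⊕ Fin m) → Form V n → Form V m
  | _, _, _, unit => unit
  | _, _, f, send s t => send (f s) (f t)
  | _, _, f, recv s t => recv (f s) (f t)
  | _, _, f, par A B => par (A.rename f) (B.rename f)
  | _, _, f, tensor A B => tensor (A.rename f) (B.rename f)
  | _, _, f, prec A B => prec (A.rename f) (B.rename f)
  | _, _, f, oplus k hk A => oplus k hk (fun i => (A i).rename f)
  | _, _, f, wth k hk A => wth k hk (fun i => (A i).rename f)
  | _, _, f, all A => all (A.rename (lift f))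
  | _, _, f, ex A => ex (A.rename (lift f))
  | _, _, f, new A => new (A.rename (lift f))
  | _, _, f, ya A => ya (A.rename (lift f))

/-- Replace the dangling index by the free variable `y`: if `Q A` is the quantified formula
`Qx.A'`, then `A.inst y` is `A'[y/x]`. -/
def inst (y : V) (A : Form V 1) : Form V 0 :=
  A.rename (Sum.elim Sum.inl (fun _ => Sum.inl y))

/-- Turn the free variable `x` into a dangling index: the quantified formula `Qx.A` is
`Q (A.close x)`. -/
def close [DecidableEq V] (x : V) (A : Form V 0) : Form V 1 :=
  A.rename (Sum.elim (fun z => if z = x then Sum.inr 0 else Sum.inl z) Fin.elim0)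

end Form

/-- The `⊕` of a family of formulas indexed by a non-empty finite set `L`
(in some enumeration of `L`). -/
noncomputable def bigOplus {V : Type u} {Label : Type v} {n : ℕ} {L : Finset Label}
    (hL : L.Nonempty) (A : L → Form V n) : Form V n :=
  Form.oplus L.card hL.card_pos (fun i => A (L.equivFin.symm i))

/-- The `&` of a family of formulas indexed by a non-empty finite set `L`
(in some enumeration of `L`). -/
noncomputable def bigWith {V : Type u} {Label : Type v} {n : ℕ} {L : Finset Label}
    (hL : L.Nonempty) (A : L → Form V n) : Form V n :=
  Form.wth L.card hL.card_pos (fun i => A (L.equivFin.symm i))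

/-! ## The sequent calculus `PiL` -/

/-- The two kinds of nominal variables. -/
inductive Nom
  | new
  | ya

/-- The variable `x` occurs in the set of nominal variables `S`. -/
def Occurs {V : Type u} (x : V) (S : Multiset (Nom × V)) : Prop := x ∈ S.map Prod.snd

/-- `S` is a nominal store: a finite set of nominal variables in which each variable occurs at
most once. -/
def IsStore {V : Type u} (S : Multiset (Nom × V)) : Prop := (S.map Prod.snd).Nodup

/-- `x` is fresh for a sequent. -/
def FreshFor {V : Type u} (x : V) (Γ : Multiset (Form V 0)) : Prop := ∀ B ∈ Γ, x ∉ B.fv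

/-- `Derives S Γ`: the judgement with store `S` and sequent `Γ` is derivable in `PiL` (which does
not contain the cut rule). The eigenvariable of the rules for `∀` and for the nominal quantifiers
is any variable that is fresh for the conclusion of the rule (its sequent and its store). -/
inductive Derives {V : Type u} : Multiset (Nom × V) → Multiset (Form V 0) → Prop
  | ax {S : Multiset (Nom × V)} (hS : IsStore S) (x y : V) :
      Derives S {Form.send (Sum.inl x) (Sum.inl y), Form.recv (Sum.inl x) (Sum.inl y)}
  | unit {S : Multiset (Nom × V)} (hS : IsStore S) : Derives S {Form.unit}
  | par {S : Multiset (Nom × V)} {Γ : Multiset (Form V 0)} {A B : Form V 0} :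
      Derives S (A ::ₘ B ::ₘ Γ) → Derives S (Form.par A B ::ₘ Γ)
  | tensor {S₁ S₂ : Multiset (Nom × V)} {Γ Δ : Multiset (Form V 0)} {A B : Form V 0}
      (hS : IsStore (S₁ + S₂)) :
      Derives S₁ (A ::ₘ Γ) → Derives S₂ (B ::ₘ Δ) →
      Derives (S₁ + S₂) (Form.tensor A B ::ₘ (Γ + Δ))
  | mix {S₁ S₂ : Multiset (Nom × V)} {Γ Δ : Multiset (Form V 0)}
      (hS : IsStore (S₁ + S₂)) :
      Derives S₁ Γ → Derives S₂ Δ → Derives (S₁ + S₂) (Γ + Δ)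
  | oplus {S : Multiset (Nom × V)} {Γ : Multiset (Form V 0)} {k : ℕ} {hk : 0 < k}
      {A : Fin k → Form V 0} (i : Fin k) :
      Derives S (A i ::ₘ Γ) → Derives S (Form.oplus k hk A ::ₘ Γ)
  | wth {S : Multiset (Nom × V)} {Γ : Multiset (Form V 0)} {k : ℕ} {hk : 0 < k}
      {A : Fin k → Form V 0} :
      (∀ i, Derives S (A i ::ₘ Γ)) → Derives S (Form.wth k hk A ::ₘ Γ)
  | all {S : Multiset (Nom × V)} {Γ : Multiset (Form V 0)} {A : Form V 1} (x : V)
      (hx : FreshFor x (Form.all A ::ₘ Γ)) (hxS : ¬ Occurs x S) :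
      Derives S (A.inst x ::ₘ Γ) → Derives S (Form.all A ::ₘ Γ)
  | ex {S : Multiset (Nom × V)} {Γ : Multiset (Form V 0)} {A : Form V 1} (y : V) :
      Derives S (A.inst y ::ₘ Γ) → Derives S (Form.ex A ::ₘ Γ)
  | prec {S₁ S₂ : Multiset (Nom × V)} {Γ Δ : Multiset (Form V 0)} {A B C D : Form V 0}
      (hS : IsStore (S₁ + S₂)) :
      Derives S₁ (A ::ₘ C ::ₘ Γ) → Derives S₂ (B ::ₘ D ::ₘ Δ) →
      Derives (S₁ + S₂) (Form.prec A B ::ₘ Form.prec C D ::ₘ (Γ + Δ))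
  | precUnit {S₁ S₂ : Multiset (Nom × V)} {Γ Δ : Multiset (Form V 0)} {A B : Form V 0}
      (hS : IsStore (S₁ + S₂)) :
      Derives S₁ (A ::ₘ Γ) → Derives S₂ (B ::ₘ Δ) →
      Derives (S₁ + S₂) (Form.prec A B ::ₘ (Γ + Δ))
  | newUnit {S : Multiset (Nom × V)} {Γ : Multiset (Form V 0)} {A : Form V 1} (x : V)
      (hx : FreshFor x (Form.new A ::ₘ Γ)) (hxS : ¬ Occurs x S) :
      Derives S (A.inst x ::ₘ Γ) → Derives S (Form.new A ::ₘ Γ)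
  | newLoad {S : Multiset (Nom × V)} {Γ : Multiset (Form V 0)} {A : Form V 1} (x : V)
      (hx : FreshFor x (Form.new A ::ₘ Γ)) (hxS : ¬ Occurs x S) :
      Derives ((Nom.new, x) ::ₘ S) (A.inst x ::ₘ Γ) → Derives S (Form.new A ::ₘ Γ)
  | newPop {S : Multiset (Nom × V)} {Γ : Multiset (Form V 0)} {A : Form V 1} (y : V)
      (hyS : ¬ Occurs y S) :
      Derives S (A.inst y ::ₘ Γ) → Derives ((Nom.new, y) ::ₘ S) (Form.ya A ::ₘ Γ)
  | yaUnit {S : Multiset (Nom × V)} {Γ : Multiset (Form V 0)} {A : Form V 1} (x : V)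
      (hx : FreshFor x (Form.ya A ::ₘ Γ)) (hxS : ¬ Occurs x S) :
      Derives S (A.inst x ::ₘ Γ) → Derives S (Form.ya A ::ₘ Γ)
  | yaLoad {S : Multiset (Nom × V)} {Γ : Multiset (Form V 0)} {A : Form V 1} (x : V)
      (hx : FreshFor x (Form.ya A ::ₘ Γ)) (hxS : ¬ Occurs x S) :
      Derives ((Nom.ya, x) ::ₘ S) (A.inst x ::ₘ Γ) → Derives S (Form.ya A ::ₘ Γ)
  | yaPop {S : Multiset (Nom × V)} {Γ : Multiset (Form V 0)} {A : Form V 1} (y : V)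
      (hyS : ¬ Occurs y S) :
      Derives S (A.inst y ::ₘ Γ) → Derives ((Nom.ya, y) ::ₘ S) (Form.new A ::ₘ Γ)

/-- `⊢ A` in `PiL`: derivability of the one-formula sequent with the empty store. -/
def Provable {V : Type u} (A : Form V 0) : Prop := Derives 0 {A}

/-! ## The recursion-free π-calculus -/

/-- Processes over channel names `Name` and labels `Label`; label sends and receives carry a
non-empty finite set `L` of labels with a continuation for each label in `L`. -/
inductive Proc (Name : Type u) (Label : Type v) : Type (max u v)
  | nil : Proc Name Label
  | send (x y : Name) (P : Proc Name Label) : Proc Name Label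
  | recv (x y : Name) (P : Proc Name Label) : Proc Name Label
  | par (P Q : Proc Name Label) : Proc Name Label
  | nu (x : Name) (P : Proc Name Label) : Proc Name Label
  | lsend (x : Name) (L : Finset Label) (hL : L.Nonempty) (P : L → Proc Name Label) :
      Proc Name Label
  | lrecv (x : Name) (L : Finset Label) (hL : L.Nonempty) (P : L → Proc Name Label) :
      Proc Name Label

namespace Proc

variable {Name : Type u} {Label : Type v}

/-- Free names. -/
def fn : Proc Name Label → Set Name
  | nil => ∅
  | send x y P => {x, y} ∪ P.fn
  | recv x y P => {x} ∪ (P.fn \ {y})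
  | par P Q => P.fn ∪ Q.fn
  | nu x P => P.fn \ {x}
  | lsend x _ _ P => {x} ∪ ⋃ l, (P l).fn
  | lrecv x _ _ P => {x} ∪ ⋃ l, (P l).fn

/-- Bound names. -/
def bn : Proc Name Label → Set Name
  | nil => ∅
  | send _ _ P => P.bn
  | recv _ y P => {y} ∪ P.bn
  | par P Q => P.bn ∪ Q.bn
  | nu x P => {x} ∪ P.bn
  | lsend _ _ _ P => ⋃ l, (P l).bn
  | lrecv _ _ _ P => ⋃ l, (P l).bn

/-- `P.subst a b` is `P[a/b]`, the replacement of the free occurrences of `b` by `a`. It is only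
used when `a` is not bound in `P`, so that nothing is captured. -/
def subst [DecidableEq Name] (a b : Name) : Proc Name Label → Proc Name Label
  | nil => nil
  | send x y P => send (if x = b then a else x) (if y = b then a else y) (P.subst a b)
  | recv x y P => recv (if x = b then a else x) y (if y = b then P else P.subst a b)
  | par P Q => par (P.subst a b) (Q.subst a b)
  | nu x P => nu x (if x = b then P else P.subst a b)
  | lsend x L hL P => lsend (if x = b then a else x) L hL (fun l => (P l).subst a b)
  | lrecv x L hL P => lrecv (if x = b then a else x) L hL (fun l => (P l).subst a b)

/-- The structural precongruence: the least reflexive and transitive relation that contains the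
generators and is closed under all process constructors. -/
inductive PreCong : Proc Name Label → Proc Name Label → Prop
  | parComm (P Q : Proc Name Label) : PreCong (par P Q) (par Q P)
  | parAssoc (P Q R : Proc Name Label) : PreCong (par (par P Q) R) (par P (par Q R))
  | parAssoc' (P Q R : Proc Name Label) : PreCong (par P (par Q R)) (par (par P Q) R)
  | nuComm (x y : Name) (P : Proc Name Label) : PreCong (nu x (nu y P)) (nu y (nu x P))
  | parNil (P : Proc Name Label) : PreCong (par P nil) P
  | nuErase (x : Name) (S : Proc Name Label) (hx : x ∉ S.fn) : PreCong (nu x S) S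
  | extrude (x : Name) (P S : Proc Name Label) (hx : x ∉ S.fn) :
      PreCong (par (nu x P) S) (nu x (par P S))
  | refl (P : Proc Name Label) : PreCong P P
  | trans {P Q R : Proc Name Label} : PreCong P Q → PreCong Q R → PreCong P R
  | send (x y : Name) {P P' : Proc Name Label} :
      PreCong P P' → PreCong (send x y P) (send x y P')
  | recv (x y : Name) {P P' : Proc Name Label} :
      PreCong P P' → PreCong (recv x y P) (recv x y P')
  | par {P P' Q Q' : Proc Name Label} :
      PreCong P P' → PreCong Q Q' → PreCong (par P Q) (par P' Q')
  | nu (x : Name) {P P' : Proc Name Label} : PreCong P P' → PreCong (nu x P) (nu x P')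
  | lsend (x : Name) {L : Finset Label} (hL : L.Nonempty) {P P' : L → Proc Name Label} :
      (∀ l, PreCong (P l) (P' l)) → PreCong (lsend x L hL P) (lsend x L hL P')
  | lrecv (x : Name) {L : Finset Label} (hL : L.Nonempty) {P P' : L → Proc Name Label} :
      (∀ l, PreCong (P l) (P' l)) → PreCong (lrecv x L hL P) (lrecv x L hL P')

/-- The names of the reduction rules. -/
inductive Rule
  | com
  | choice
  | label
  | res
  | par
  | struc

/-- `Red last core P P'`: there is a derivation of the reduction step `P → P'` whose last rule is
`last` and whose core-reduction (the rule `com`, `choice` or `label` at the top of the derivation,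
which rewrites the core-redex into the core-reductum) is `core`. -/
inductive Red [DecidableEq Name] : Rule → Rule → Proc Name Label → Proc Name Label → Prop
  | com (x a b : Name) (P Q : Proc Name Label) (ha : a ∉ Q.bn) :
      Red Rule.com Rule.com (par (send x a P) (recv x b Q)) (par P (Q.subst a b))
  | choice (x : Name) (L : Finset Label) (hL : L.Nonempty) (P : L → Proc Name Label) (k : L) :
      Red Rule.choice Rule.choice (lsend x L hL P)
        (lsend x {k.1} (Finset.singleton_nonempty k.1) (fun _ => P k))
  | label (x : Name) (L : Finset Label) (hL : L.Nonempty) (P : Proc Name Label)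
      (Q : L → Proc Name Label) (k : L) :
      Red Rule.label Rule.label
        (par (lsend x {k.1} (Finset.singleton_nonempty k.1) (fun _ => P)) (lrecv x L hL Q))
        (par P (Q k))
  | res {r c : Rule} (x : Name) {P P' : Proc Name Label} :
      Red r c P P' → Red Rule.res c (nu x P) (nu x P')
  | par {r c : Rule} {P P' : Proc Name Label} (Q : Proc Name Label) :
      Red r c P P' → Red Rule.par c (par P Q) (par P' Q)
  | struc {r c : Rule} {P P' Q : Proc Name Label} :
      PreCong P P' → P ≠ P' → Red r c P' Q → r ≠ Rule.struc → Red Rule.struc c P Q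

/-- `P → P'` by a step with core-reduction `core`. -/
def ReducesBy [DecidableEq Name] (core : Rule) (P P' : Proc Name Label) : Prop :=
  ∃ last, Red last core P P'

/-- `P → P'`. -/
def Reduces [DecidableEq Name] (P P' : Proc Name Label) : Prop := ∃ core, ReducesBy core P P'

/-- The translation of processes into formulas. The variables of the formulas are the names and
the labels. In the clause for `recv` the scope of the binder `y` comprises the transmitted
variable and the continuation, not the channel `x`. -/
noncomputable def toForm [DecidableEq Name] [DecidableEq Label] :
    Proc Name Label → Form (Name ⊕ Label) 0
  | nil => Form.unit
  | send x y P => Form.prec (Form.send (Sum.inl (Sum.inl x)) (Sum.inl (Sum.inl y))) P.toForm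
  | recv x y P =>
      Form.ex (Form.prec (Form.recv (Sum.inl (Sum.inl x)) (Sum.inr 0))
        (P.toForm.close (Sum.inl y)))
  | par P Q => Form.par P.toForm Q.toForm
  | nu x P => Form.new (P.toForm.close (Sum.inl x))
  | lsend x _ hL P => bigWith hL (fun l =>
      Form.prec (Form.send (Sum.inl (Sum.inl x)) (Sum.inl (Sum.inr l.1))) (P l).toForm)
  | lrecv x _ hL P => bigOplus hL (fun l =>
      Form.prec (Form.recv (Sum.inl (Sum.inl x)) (Sum.inl (Sum.inr l.1))) (P l).toForm)

end Proc

end PiL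

/-! The calculus has no cut, so implications cannot simply be chained. Instead, each process step is
read as an operation on derivations. `Entails A B` says that, in every context and under every
renaming of variables, derivations of all the `A i` yield one of `B`. Such statements compose
trivially, which replaces cut. Applied to the context `A.neg` and the identity derivation of `A.neg,
A`, they give the implication. For a choice, the context is the negation of the whole `&`, and its
`⊕` selects each branch.

To transform derivations one must take formulas apart. In the full calculus `new` can be introduced
in several ways, so `CDerives` restricts to a fragment where it only loads the store and `ya` only
pops it. There `par`, `wth` and `new` are invertible (`par_inv`, `wth_inv`, `new_inv`), and the
fragment still proves identity and embeds in `PiL` (`CDerives.derives`). The connectives `prec`,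
`oplus` and `ex` are not inverted; a subformula below them is changed at the place where the
connective is introduced. Both techniques come from one lemma, `CDerives.replace`.

The generators of the precongruence then become manipulations of derivations: reordering a sequent
for the parallel laws, adding a unit for `Nil`, adding an unused store variable for an erased
restriction, and inverting and reloading `new` for the other restriction laws. A communication or a
label selection is one `prec` rule whose left premise is an axiom. A choice recombines the branches
of a `&`. Reduction contexts preserve entailment, including entailment from a finite family.

Renamings enter because opening a binder replaces the bound variable. Freshness is handled by the
cofinite filter: a derivation has to avoid only finitely many variables. -/

open Filter

namespace PiL

/-! ### Renaming of free variables, binders and instantiation. -/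

namespace Form

variable {V : Type u}

/-- The free variables and dangling indices that occur in a formula. -/
def occ : {n : ℕ} → Form V n → Set (V ⊕ Fin n)
  | _, unit => ∅
  | _, send s t => {s, t}
  | _, recv s t => {s, t}
  | _, par A B => A.occ ∪ B.occ
  | _, tensor A B => A.occ ∪ B.occ
  | _, prec A B => A.occ ∪ B.occ
  | _, oplus _ _ A => ⋃ i, (A i).occ
  | _, wth _ _ A => ⋃ i, (A i).occ
  | _, all A => shift ⁻¹' A.occ
  | _, ex A => shift ⁻¹' A.occ
  | _, new A => shift ⁻¹' A.occ
  | _, ya A => shift ⁻¹' A.occ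

theorem mem_fv {n : ℕ} {A : Form V n} {z : V} : z ∈ A.fv ↔ Sum.inl z ∈ A.occ := by
  induction A with
  | send s t => simp [fv, occ, eq_comm]
  | recv s t => simp [fv, occ, eq_comm]
  | _ => simp_all [fv, occ, shift]

theorem shift_injective {n : ℕ} : Function.Injective (shift : V ⊕ Fin n → V ⊕ Fin (n + 1)) := by
  rintro (a | a) (b | b) h <;> simp_all [shift]

theorem finite_occ {n : ℕ} (A : Form V n) : A.occ.Finite := by
  induction A with
  | unit => exact Set.finite_empty
  | send s t => exact Set.toFinite {s, t}
  | recv s t => exact Set.toFinite {s, t}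
  | par A B hA hB => exact hA.union hB
  | tensor A B hA hB => exact hA.union hB
  | prec A B hA hB => exact hA.union hB
  | oplus k hk A h => exact Set.finite_iUnion h
  | wth k hk A h => exact Set.finite_iUnion h
  | all A h => exact h.preimage shift_injective.injOn
  | ex A h => exact h.preimage shift_injective.injOn
  | new A h => exact h.preimage shift_injective.injOn
  | ya A h => exact h.preimage shift_injective.injOn

theorem finite_fv {n : ℕ} (A : Form V n) : A.fv.Finite := by
  have : A.fv = Sum.inl ⁻¹' A.occ := Set.ext fun _ => mem_fv
  exact this ▸ A.finite_occ.preimage Sum.inl_injective.injOn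

theorem lift_shift {n m : ℕ} (f : V ⊕ Fin n → V ⊕ Fin m) (s : V ⊕ Fin n) :
    lift f (shift s) = shift (f s) := by
  rcases s with s | s <;> simp [lift, shift]

@[simp]
theorem lift_inl {n m : ℕ} (f : V ⊕ Fin n → V ⊕ Fin m) (z : V) :
    lift f (Sum.inl z) = shift (f (Sum.inl z)) := rfl

theorem eq_zero_or_shift {n : ℕ} (s : V ⊕ Fin (n + 1)) : s = Sum.inr 0 ∨ ∃ t, s = shift t := by
  rcases s with z | i
  · exact Or.inr ⟨Sum.inl z, rfl⟩
  · refine Fin.cases (Or.inl rfl) (fun j => Or.inr ⟨Sum.inr j, rfl⟩) i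

theorem shift_ne_zero {n : ℕ} (s : V ⊕ Fin n) : shift s ≠ Sum.inr 0 := by
  rcases s with s | s <;> simp [shift]

theorem lift_comp {n m p : ℕ} (g : V ⊕ Fin m → V ⊕ Fin p) (f : V ⊕ Fin n → V ⊕ Fin m) :
    lift g ∘ lift f = lift (g ∘ f) := by
  funext s
  rcases eq_zero_or_shift s with rfl | ⟨t, rfl⟩
  · rfl
  · simp [lift_shift]

theorem preimage_lift_image {n m : ℕ} (f : V ⊕ Fin n → V ⊕ Fin m) (s : Set (V ⊕ Fin (n + 1))) :
    shift ⁻¹' (lift f '' s) = f '' (shift ⁻¹' s) := by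
  ext t
  constructor
  · rintro ⟨r, hr, h⟩
    rcases eq_zero_or_shift r with rfl | ⟨q, rfl⟩
    · exact absurd h.symm (shift_ne_zero t)
    · exact ⟨q, hr, shift_injective ((lift_shift f q).symm.trans h)⟩
  · rintro ⟨q, hq, rfl⟩
    exact ⟨shift q, hq, lift_shift f q⟩

theorem occ_rename {n m : ℕ} (f : V ⊕ Fin n → V ⊕ Fin m) (A : Form V n) :
    (A.rename f).occ = f '' A.occ := by
  induction A generalizing m with
  | unit => simp [rename, occ]
  | send s t => simp [rename, occ, Set.image_pair]
  | recv s t => simp [rename, occ, Set.image_pair]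
  | _ => simp_all [rename, occ, Set.image_union, Set.image_iUnion, preimage_lift_image]

theorem rename_rename {n m p : ℕ} (g : V ⊕ Fin m → V ⊕ Fin p) (f : V ⊕ Fin n → V ⊕ Fin m)
    (A : Form V n) : (A.rename f).rename g = A.rename (g ∘ f) := by
  induction A generalizing m p with
  | _ => simp_all [rename, lift_comp]

theorem lift_eqOn {n m : ℕ} {f g : V ⊕ Fin n → V ⊕ Fin m} {s : Set (V ⊕ Fin (n + 1))}
    (h : Set.EqOn f g (shift ⁻¹' s)) : Set.EqOn (lift f) (lift g) s := by
  intro r hr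
  rcases eq_zero_or_shift r with rfl | ⟨q, rfl⟩
  · rfl
  · rw [lift_shift, lift_shift, h hr]

theorem rename_congr {n m : ℕ} {f g : V ⊕ Fin n → V ⊕ Fin m} {A : Form V n}
    (h : Set.EqOn f g A.occ) : A.rename f = A.rename g := by
  induction A generalizing m with
  | unit => rfl
  | send s t => simp [rename, h (show s ∈ ({s, t} : Set _) by simp),
      h (show t ∈ ({s, t} : Set _) by simp)]
  | recv s t => simp [rename, h (show s ∈ ({s, t} : Set _) by simp),
      h (show t ∈ ({s, t} : Set _) by simp)]
  | par A B hA hB | tensor A B hA hB | prec A B hA hB =>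
    simp only [rename]
    rw [hA (h.mono Set.subset_union_left), hB (h.mono Set.subset_union_right)]
  | oplus k hk A ih | wth k hk A ih =>
    simp only [rename]
    congr 1
    funext i
    exact ih i (h.mono (Set.subset_iUnion (fun j => (A j).occ) i))
  | all A ih | ex A ih | new A ih | ya A ih =>
    simp only [rename]
    rw [ih (lift_eqOn h)]

theorem neg_rename {n m : ℕ} (f : V ⊕ Fin n → V ⊕ Fin m) (A : Form V n) :
    (A.rename f).neg = A.neg.rename f := by
  induction A generalizing m with
  | _ => simp_all [rename, neg]

theorem lift_id {n : ℕ} : lift (id : V ⊕ Fin n → V ⊕ Fin n) = id := by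
  funext s
  rcases eq_zero_or_shift s with rfl | ⟨t, rfl⟩
  · rfl
  · simp [lift_shift]

theorem rename_id {n : ℕ} (A : Form V n) : A.rename id = A := by
  induction A with
  | _ => simp_all [rename, lift_id]

/-- Renaming of the free variables of a formula. -/
def map (f : V → V) {n : ℕ} (A : Form V n) : Form V n := A.rename (Sum.map f id)

theorem lift_map (f : V → V) {n : ℕ} :
    lift (Sum.map f id : V ⊕ Fin n → V ⊕ Fin n) = Sum.map f id := by
  funext s
  rcases eq_zero_or_shift s with rfl | ⟨t | t, rfl⟩
  · rfl
  · simp [shift]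
  · simp [lift_shift]; simp [shift]

theorem map_id {n : ℕ} (A : Form V n) : A.map id = A := by
  rw [map, Sum.map_id_id, rename_id]

theorem map_map (g f : V → V) {n : ℕ} (A : Form V n) : (A.map f).map g = A.map (g ∘ f) := by
  rw [map, map, map, rename_rename, Sum.map_comp_map, Function.comp_id]

theorem fv_map (f : V → V) {n : ℕ} (A : Form V n) : (A.map f).fv = f '' A.fv := by
  ext z
  simp [mem_fv, map, occ_rename]

theorem map_congr {f g : V → V} {n : ℕ} {A : Form V n} (h : Set.EqOn f g A.fv) :
    A.map f = A.map g := by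
  refine rename_congr ?_
  rintro (z | i) hz
  · exact congrArg Sum.inl (h (mem_fv.2 hz))
  · rfl

theorem map_inst (f : V → V) (y : V) (A : Form V 1) :
    (A.inst y).map f = (A.map f).inst (f y) := by
  rw [inst, inst, map, map, rename_rename, rename_rename]
  congr 1
  funext s
  rcases s with s | s <;> simp

theorem neg_inst (y : V) (A : Form V 1) : (A.inst y).neg = A.neg.inst y := neg_rename _ _

theorem fv_inst_subset (y : V) (A : Form V 1) : (A.inst y).fv ⊆ insert y A.fv := by
  intro z hz
  rw [mem_fv, inst, occ_rename] at hz
  obtain ⟨s | s, hs, h⟩ := hz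
  · cases h
    exact Or.inr (mem_fv.2 hs)
  · cases h
    exact Or.inl rfl

theorem fv_close [DecidableEq V] (x : V) (A : Form V 0) : (A.close x).fv = A.fv \ {x} := by
  ext z
  rw [mem_fv, close, occ_rename, Set.mem_sdiff, mem_fv]
  constructor
  · rintro ⟨s | s, hs, h⟩
    · by_cases hsx : s = x
      · simp [hsx] at h
      · simp [hsx] at h
        subst h
        exact ⟨hs, hsx⟩
    · exact s.elim0
  · rintro ⟨hz, hzx⟩
    exact ⟨_, hz, by simpa using hzx⟩

/-- Opening a binder below a renaming `f` is again a renaming, namely `f` updated at the bound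
variable. The update need not be injective, so entailment is required for arbitrary `f`. -/
theorem inst_map_close [DecidableEq V] (f : V → V) (x y : V) (A : Form V 0) :
    ((A.close x).map f).inst y = A.map (Function.update f x y) := by
  rw [close, inst, map, map, rename_rename, rename_rename]
  congr 1
  funext s
  rcases s with s | s
  · by_cases h : s = x
    · subst h; simp
    · simp [h]
  · exact s.elim0

theorem close_map [DecidableEq V] {f : V → V} {x : V} (A : Form V 0)
    (h : ∀ z ∈ A.fv, f z = x ↔ z = x) (hx : f x = x) :
    (A.map f).close x = (A.close x).map f := by
  rw [close, close, map, map, rename_rename, rename_rename]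
  refine rename_congr ?_
  rintro (s | s) hs
  · by_cases hsx : s = x
    · subst hsx; simp [hx]
    · simp [hsx, h s (mem_fv.2 hs)]
  · exact s.elim0

section

variable (f : V → V) {n : ℕ}

@[simp] theorem map_unit : (unit : Form V n).map f = unit := rfl
@[simp] theorem map_send (s t : V ⊕ Fin n) :
    (send s t).map f = send (s.map f id) (t.map f id) := rfl
@[simp] theorem map_recv (s t : V ⊕ Fin n) :
    (recv s t).map f = recv (s.map f id) (t.map f id) := rfl
@[simp] theorem map_par (A B : Form V n) : (par A B).map f = par (A.map f) (B.map f) := rfl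
@[simp] theorem map_tensor (A B : Form V n) :
    (tensor A B).map f = tensor (A.map f) (B.map f) := rfl
@[simp] theorem map_prec (A B : Form V n) : (prec A B).map f = prec (A.map f) (B.map f) := rfl
@[simp] theorem map_oplus (k : ℕ) (hk : 0 < k) (A : Fin k → Form V n) :
    (oplus k hk A).map f = oplus k hk (fun i => (A i).map f) := rfl
@[simp] theorem map_wth (k : ℕ) (hk : 0 < k) (A : Fin k → Form V n) :
    (wth k hk A).map f = wth k hk (fun i => (A i).map f) := rfl
@[simp] theorem map_all (A : Form V (n + 1)) : (all A).map f = all (A.map f) := by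
  simp [map, rename, lift_map]
@[simp] theorem map_ex (A : Form V (n + 1)) : (ex A).map f = ex (A.map f) := by
  simp [map, rename, lift_map]
@[simp] theorem map_new (A : Form V (n + 1)) : (new A).map f = new (A.map f) := by
  simp [map, rename, lift_map]
@[simp] theorem map_ya (A : Form V (n + 1)) : (ya A).map f = ya (A.map f) := by
  simp [map, rename, lift_map]

end

end Form

/-! ## Canonical derivations

The fragment of `PiL` in which the only rules for the nominal quantifiers are loading a variable
for `new` and popping it for `ya`. In this fragment the rules for `par`, `wth` and `new` are
invertible. Its stores contain only variables marked `new`. -/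

/-- Canonical derivability. -/
inductive CDerives {V : Type u} : Multiset V → Multiset (Form V 0) → Prop
  | ax (S : Multiset V) (x y : V) :
      CDerives S {Form.send (Sum.inl x) (Sum.inl y), Form.recv (Sum.inl x) (Sum.inl y)}
  | unit (S : Multiset V) : CDerives S {Form.unit}
  | unitMix {S : Multiset V} {Γ : Multiset (Form V 0)} :
      CDerives S Γ → CDerives S (Form.unit ::ₘ Γ)
  | par {S : Multiset V} {Γ : Multiset (Form V 0)} {A B : Form V 0} :
      CDerives S (A ::ₘ B ::ₘ Γ) → CDerives S (Form.par A B ::ₘ Γ)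
  | tensor {S₁ S₂ : Multiset V} {Γ Δ : Multiset (Form V 0)} {A B : Form V 0} :
      CDerives S₁ (A ::ₘ Γ) → CDerives S₂ (B ::ₘ Δ) →
      CDerives (S₁ + S₂) (Form.tensor A B ::ₘ (Γ + Δ))
  | prec {S₁ S₂ : Multiset V} {Γ Δ : Multiset (Form V 0)} {A B C D : Form V 0} :
      CDerives S₁ (A ::ₘ C ::ₘ Γ) → CDerives S₂ (B ::ₘ D ::ₘ Δ) →
      CDerives (S₁ + S₂) (Form.prec A B ::ₘ Form.prec C D ::ₘ (Γ + Δ))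
  | oplus {S : Multiset V} {Γ : Multiset (Form V 0)} {k : ℕ} {hk : 0 < k}
      {A : Fin k → Form V 0} (i : Fin k) :
      CDerives S (A i ::ₘ Γ) → CDerives S (Form.oplus k hk A ::ₘ Γ)
  | wth {S : Multiset V} {Γ : Multiset (Form V 0)} {k : ℕ} {hk : 0 < k}
      {A : Fin k → Form V 0} :
      (∀ i, CDerives S (A i ::ₘ Γ)) → CDerives S (Form.wth k hk A ::ₘ Γ)
  | all {S : Multiset V} {Γ : Multiset (Form V 0)} {A : Form V 1} (x : V)
      (hx : FreshFor x (Form.all A ::ₘ Γ)) (hxS : x ∉ S) :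
      CDerives S (A.inst x ::ₘ Γ) → CDerives S (Form.all A ::ₘ Γ)
  | ex {S : Multiset V} {Γ : Multiset (Form V 0)} {A : Form V 1} (y : V) :
      CDerives S (A.inst y ::ₘ Γ) → CDerives S (Form.ex A ::ₘ Γ)
  | load {S : Multiset V} {Γ : Multiset (Form V 0)} {A : Form V 1} (x : V)
      (hx : FreshFor x (Form.new A ::ₘ Γ)) (hxS : x ∉ S) :
      CDerives (x ::ₘ S) (A.inst x ::ₘ Γ) → CDerives S (Form.new A ::ₘ Γ)
  | pop {S : Multiset V} {Γ : Multiset (Form V 0)} {A : Form V 1} (y : V) :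
      CDerives S (A.inst y ::ₘ Γ) → CDerives (y ::ₘ S) (Form.ya A ::ₘ Γ)

/-- `Intro S X Γ`: the sequent `X, Γ` follows with the store `S` by a canonical rule that
introduces `X`. -/
inductive Intro {V : Type u} : Multiset V → Form V 0 → Multiset (Form V 0) → Prop
  | send (S : Multiset V) (x y : V) :
      Intro S (Form.send (Sum.inl x) (Sum.inl y)) {Form.recv (Sum.inl x) (Sum.inl y)}
  | recv (S : Multiset V) (x y : V) :
      Intro S (Form.recv (Sum.inl x) (Sum.inl y)) {Form.send (Sum.inl x) (Sum.inl y)}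
  | unit (S : Multiset V) : Intro S Form.unit 0
  | unitMix {S : Multiset V} {Γ : Multiset (Form V 0)} : CDerives S Γ → Intro S Form.unit Γ
  | par {S : Multiset V} {Γ : Multiset (Form V 0)} {A B : Form V 0} :
      CDerives S (A ::ₘ B ::ₘ Γ) → Intro S (Form.par A B) Γ
  | tensor {S₁ S₂ : Multiset V} {Γ Δ : Multiset (Form V 0)} {A B : Form V 0} :
      CDerives S₁ (A ::ₘ Γ) → CDerives S₂ (B ::ₘ Δ) →
      Intro (S₁ + S₂) (Form.tensor A B) (Γ + Δ)
  | prec {S₁ S₂ : Multiset V} {Γ Δ : Multiset (Form V 0)} {A B C D : Form V 0} :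
      CDerives S₁ (A ::ₘ C ::ₘ Γ) → CDerives S₂ (B ::ₘ D ::ₘ Δ) →
      Intro (S₁ + S₂) (Form.prec A B) (Form.prec C D ::ₘ (Γ + Δ))
  | oplus {S : Multiset V} {Γ : Multiset (Form V 0)} {k : ℕ} {hk : 0 < k}
      {A : Fin k → Form V 0} (i : Fin k) :
      CDerives S (A i ::ₘ Γ) → Intro S (Form.oplus k hk A) Γ
  | wth {S : Multiset V} {Γ : Multiset (Form V 0)} {k : ℕ} {hk : 0 < k}
      {A : Fin k → Form V 0} :
      (∀ i, CDerives S (A i ::ₘ Γ)) → Intro S (Form.wth k hk A) Γ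
  | all {S : Multiset V} {Γ : Multiset (Form V 0)} {A : Form V 1} (x : V)
      (hx : FreshFor x (Form.all A ::ₘ Γ)) (hxS : x ∉ S) :
      CDerives S (A.inst x ::ₘ Γ) → Intro S (Form.all A) Γ
  | ex {S : Multiset V} {Γ : Multiset (Form V 0)} {A : Form V 1} (y : V) :
      CDerives S (A.inst y ::ₘ Γ) → Intro S (Form.ex A) Γ
  | load {S : Multiset V} {Γ : Multiset (Form V 0)} {A : Form V 1} (x : V)
      (hx : FreshFor x (Form.new A ::ₘ Γ)) (hxS : x ∉ S) :
      CDerives (x ::ₘ S) (A.inst x ::ₘ Γ) → Intro S (Form.new A) Γ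
  | pop {S : Multiset V} {Γ : Multiset (Form V 0)} {A : Form V 1} (y : V) :
      CDerives S (A.inst y ::ₘ Γ) → Intro (y ::ₘ S) (Form.ya A) Γ

/-! ### Canonical derivations: soundness, equivariance, weakening. -/

section

variable {V : Type u}

theorem freshFor_cons {x : V} {A : Form V 0} {Γ : Multiset (Form V 0)} :
    FreshFor x (A ::ₘ Γ) ↔ x ∉ A.fv ∧ FreshFor x Γ := by
  simp [FreshFor]

theorem freshFor_add {x : V} {Γ Δ : Multiset (Form V 0)} :
    FreshFor x (Γ + Δ) ↔ FreshFor x Γ ∧ FreshFor x Δ := by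
  simp only [FreshFor, Multiset.mem_add, or_imp, forall_and]

theorem eventually_notMem_fv (A : Form V 0) : ∀ᶠ x in cofinite, x ∉ A.fv :=
  A.finite_fv.eventually_cofinite_notMem

theorem eventually_freshFor (Γ : Multiset (Form V 0)) : ∀ᶠ x in cofinite, FreshFor x Γ := by
  induction Γ using Multiset.induction_on with
  | empty => simp [FreshFor]
  | cons A Γ ih =>
    filter_upwards [ih, eventually_notMem_fv A] with x h₁ h₂
    exact freshFor_cons.2 ⟨h₂, h₁⟩

theorem eventually_notMem (S : Multiset V) : ∀ᶠ x in cofinite, x ∉ S :=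
  Set.Finite.eventually_cofinite_notMem (s := {x | x ∈ S}) S.finite_toSet

theorem eventually_ne (x : V) : ∀ᶠ y in cofinite, y ≠ x :=
  (Set.finite_singleton x).eventually_cofinite_notMem

namespace CDerives

theorem cast {S S' : Multiset V} {Γ Γ' : Multiset (Form V 0)} (h : CDerives S Γ) (hS : S = S')
    (hΓ : Γ = Γ') : CDerives S' Γ' := hS ▸ hΓ ▸ h

theorem swap {S : Multiset V} {A B : Form V 0} {Γ : Multiset (Form V 0)}
    (h : CDerives S (A ::ₘ B ::ₘ Γ)) : CDerives S (B ::ₘ A ::ₘ Γ) :=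
  h.cast rfl (Multiset.cons_swap _ _ _)

/-- Canonical stores are bare multisets; their distinctness is needed only here. It passes from
conclusion to premises, because every rule except `load` keeps or shrinks the store and `load` adds
a variable not yet in it. -/
theorem derives {S : Multiset V} {Γ : Multiset (Form V 0)} (h : CDerives S Γ) (hS : S.Nodup) :
    Derives (S.map (Prod.mk Nom.new)) Γ := by
  have store : ∀ {S : Multiset V}, S.Nodup → IsStore (S.map (Prod.mk Nom.new)) := by
    intro S hS
    simpa [IsStore] using hS
  have occurs : ∀ {x : V} {S : Multiset V}, x ∉ S → ¬ Occurs x (S.map (Prod.mk Nom.new)) := by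
    intro x S hx
    simpa [Occurs] using hx
  induction h with
  | ax S x y => exact .ax (store hS) x y
  | unit S => exact .unit (store hS)
  | @unitMix S Γ _ ih =>
    -- The unit is derived with the empty store and mixed in, so the whole store stays with `Γ`.
    have := Derives.mix (by simpa using store hS) (.unit (S := 0) (by simp [IsStore])) (ih hS)
    rwa [zero_add, Multiset.singleton_add] at this
  | par _ ih => exact .par (ih hS)
  | tensor _ _ ih₁ ih₂ =>
    have h := Multiset.nodup_add.1 hS
    rw [Multiset.map_add]
    exact .tensor (by simpa using store hS) (ih₁ h.1) (ih₂ h.2.1)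
  | prec _ _ ih₁ ih₂ =>
    have h := Multiset.nodup_add.1 hS
    rw [Multiset.map_add]
    exact .prec (by simpa using store hS) (ih₁ h.1) (ih₂ h.2.1)
  | oplus i _ ih => exact .oplus i (ih hS)
  | wth _ ih => exact .wth fun i => ih i hS
  | all x hx hxS _ ih => exact .all x hx (occurs hxS) (ih hS)
  | ex y _ ih => exact .ex y (ih hS)
  | load x hx hxS _ ih =>
    refine .newLoad x hx (occurs hxS) ?_
    simpa using ih (Multiset.nodup_cons.2 ⟨hxS, hS⟩)
  | pop y _ ih =>
    have h := Multiset.nodup_cons.1 hS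
    rw [Multiset.map_cons]
    exact .newPop y (occurs h.1) (ih h.2)

/-- Canonical derivability is equivariant. -/
theorem map (π : Equiv.Perm V) {S : Multiset V} {Γ : Multiset (Form V 0)} (h : CDerives S Γ) :
    CDerives (S.map π) (Γ.map (Form.map π)) := by
  have fresh : ∀ {x : V} {Γ : Multiset (Form V 0)}, FreshFor x Γ →
      FreshFor (π x) (Γ.map (Form.map π)) := by
    intro x Γ hx B hB
    obtain ⟨A, hA, rfl⟩ := Multiset.mem_map.1 hB
    simpa [Form.fv_map] using hx A hA
  induction h with
  | ax S x y => exact .ax _ _ _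
  | unit S => exact .unit _
  | unitMix _ ih => simpa using ih.unitMix
  | par _ ih => simpa using CDerives.par (by simpa using ih)
  | tensor _ _ ih₁ ih₂ =>
    simpa using CDerives.tensor (by simpa using ih₁) (by simpa using ih₂)
  | prec _ _ ih₁ ih₂ =>
    simpa using CDerives.prec (by simpa using ih₁) (by simpa using ih₂)
  | oplus i _ ih =>
    simp only [Multiset.map_cons, Form.map_oplus] at ih ⊢
    exact .oplus i ih
  | wth _ ih =>
    simp only [Multiset.map_cons, Form.map_wth] at ih ⊢
    exact .wth ih
  | all x hx hxS _ ih =>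
    have h := fresh hx
    simp only [Multiset.map_cons, Form.map_all, Form.map_inst] at ih h ⊢
    exact .all _ h (by simpa using hxS) ih
  | ex y _ ih =>
    simp only [Multiset.map_cons, Form.map_ex, Form.map_inst] at ih ⊢
    exact .ex _ ih
  | load x hx hxS _ ih =>
    have h := fresh hx
    simp only [Multiset.map_cons, Form.map_new, Form.map_inst] at ih h ⊢
    exact .load _ h (by simpa using hxS) ih
  | pop y _ ih =>
    simp only [Multiset.map_cons, Form.map_ya, Form.map_inst] at ih ⊢
    exact .pop _ ih

/-- A variable can be added to the store. -/
theorem weaken {S : Multiset V} {Γ : Multiset (Form V 0)} (h : CDerives S Γ) :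
    ∀ᶠ y in cofinite, CDerives (y ::ₘ S) Γ := by
  induction h with
  | ax S x y => exact .of_forall fun z => .ax _ _ _
  | unit S => exact .of_forall fun z => .unit _
  | unitMix _ ih => exact ih.mono fun y hy => hy.unitMix
  | par _ ih => exact ih.mono fun y hy => hy.par
  | tensor _ h₂ ih₁ _ =>
    exact ih₁.mono fun y hy => (hy.tensor h₂).cast (Multiset.cons_add _ _ _) rfl
  | prec _ h₂ ih₁ _ =>
    exact ih₁.mono fun y hy => (hy.prec h₂).cast (Multiset.cons_add _ _ _) rfl
  | oplus i _ ih => exact ih.mono fun y hy => hy.oplus i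
  | wth _ ih => exact (eventually_all.2 ih).mono fun y hy => .wth hy
  | all x hx hxS _ ih =>
    -- The added variable must avoid the eigenvariable, which excludes one more value of `y`.
    filter_upwards [ih, eventually_ne x] with y hy hyx
    exact .all x hx (by simp [hxS, hyx.symm]) hy
  | ex y _ ih => exact ih.mono fun z hz => hz.ex y
  | load x hx hxS _ ih =>
    filter_upwards [ih, eventually_ne x] with y hy hyx
    exact .load x hx (by simp [hxS, hyx.symm]) (hy.cast (Multiset.cons_swap _ _ _) rfl)
  | pop y _ ih => exact ih.mono fun z hz => (hz.pop y).cast (Multiset.cons_swap _ _ _) rfl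

/-! ### Replacement at the point of introduction, and invertibility. -/

/-- Replacement of an occurrence of `X` in a derivable sequent, given how to replace it where it
is introduced. -/
theorem replace {X : Form V 0} (T : V → Multiset V) (Ξ : V → Multiset (Form V 0))
    (hT : ∀ x y, x ≠ y → x ∉ T y) (hΞ : ∀ y, ∀ B ∈ Ξ y, B.fv ⊆ insert y X.fv)
    (hI : ∀ S Γ, Intro S X Γ → ∀ᶠ y in cofinite, CDerives (T y + S) (Ξ y + Γ))
    {S : Multiset V} {Γ : Multiset (Form V 0)} (h : CDerives S (X ::ₘ Γ)) :
    ∀ᶠ y in cofinite, CDerives (T y + S) (Ξ y + Γ) := by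
  have fresh : ∀ {x y : V} {A : Form V 0} {Γ : Multiset (Form V 0)}, y ≠ x →
      FreshFor x (A ::ₘ X ::ₘ Γ) → FreshFor x (A ::ₘ (Ξ y + Γ)) := by
    intro x y A Γ hyx h
    rw [freshFor_cons, freshFor_cons] at h
    rw [freshFor_cons, freshFor_add]
    refine ⟨h.1, fun B hB hxB => ?_, h.2.2⟩
    exact (hΞ y B hB hxB).elim (fun e => hyx e.symm) h.2.1
  have store : ∀ {x y : V} {S : Multiset V}, y ≠ x → x ∉ S → x ∉ T y + S := by
    intro x y S hyx hx
    simp [hx, hT x y hyx.symm]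
  have front : ∀ {S : Multiset V} {A : Form V 0} {Γ Δ : Multiset (Form V 0)},
      CDerives S (Δ + A ::ₘ Γ) → CDerives S (A ::ₘ (Δ + Γ)) :=
    fun h => h.cast rfl (Multiset.add_cons _ _ _)
  have back : ∀ {S : Multiset V} {A : Form V 0} {Γ Δ : Multiset (Form V 0)},
      CDerives S (A ::ₘ (Δ + Γ)) → CDerives S (Δ + A ::ₘ Γ) :=
    fun h => h.cast rfl (Multiset.add_cons _ _ _).symm
  have front₂ : ∀ {S : Multiset V} {A B : Form V 0} {Γ Δ : Multiset (Form V 0)},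
      CDerives S (Δ + A ::ₘ B ::ₘ Γ) → CDerives S (A ::ₘ B ::ₘ (Δ + Γ)) :=
    fun h => h.cast rfl (by simp)
  -- In each case of the induction either the displayed `X` is principal, and `hI` applies, or `X`
  -- belongs to the context and the rule is reapplied after replacement in the premises that contain
  -- it. Rules that split the context need a further case for the side holding `X`. In the `wth`
  -- case, the finitely many cofinite conditions are intersected.
  generalize hΘ : X ::ₘ Γ = Θ at h
  induction h generalizing Γ with
  | ax S x y =>
    rw [Multiset.insert_eq_cons, Multiset.cons_eq_cons] at hΘ
    obtain ⟨rfl, rfl⟩ | ⟨-, Γ', rfl, h⟩ := hΘ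
    · exact hI _ _ (.send S x y)
    · obtain ⟨rfl, rfl⟩ := Multiset.cons_eq_cons.1 h |>.resolve_right (by simp)
      exact hI _ _ (.recv S x y)
  | unit S =>
    obtain ⟨rfl, rfl⟩ := Multiset.cons_eq_cons.1 hΘ |>.resolve_right (by simp)
    exact hI _ _ (.unit S)
  | unitMix h ih =>
    obtain ⟨rfl, rfl⟩ | ⟨-, Γ', rfl, rfl⟩ := Multiset.cons_eq_cons.1 hΘ
    · exact hI _ _ (.unitMix h)
    · exact (ih rfl).mono fun y hy => back hy.unitMix
  | @par S Γ₀ A B h ih =>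
    obtain ⟨rfl, rfl⟩ | ⟨-, Γ', rfl, rfl⟩ := Multiset.cons_eq_cons.1 hΘ
    · exact hI _ _ (.par h)
    · refine (ih (Γ := A ::ₘ B ::ₘ Γ') ?_).mono fun y hy => back (front₂ hy).par
      rw [Multiset.cons_swap, Multiset.cons_swap X]
  | @tensor S₁ S₂ Γ₁ Γ₂ A B h₁ h₂ ih₁ ih₂ =>
    obtain ⟨rfl, rfl⟩ | ⟨-, Γ', rfl, h⟩ := Multiset.cons_eq_cons.1 hΘ
    · exact hI _ _ (.tensor h₁ h₂)
    · have hX : X ∈ Γ₁ + Γ₂ := h ▸ Multiset.mem_cons_self _ _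
      obtain hX | hX := Multiset.mem_add.1 hX
      · obtain ⟨Γ₁, rfl⟩ := Multiset.exists_cons_of_mem hX
        rw [Multiset.cons_add, Multiset.cons_inj_right] at h
        subst h
        refine (ih₁ (Multiset.cons_swap _ _ _)).mono fun y hy => ?_
        refine back (((front hy).tensor h₂).cast (add_assoc _ _ _) ?_)
        rw [add_assoc]
      · obtain ⟨Γ₂, rfl⟩ := Multiset.exists_cons_of_mem hX
        rw [Multiset.add_cons, Multiset.cons_inj_right] at h
        subst h
        refine (ih₂ (Multiset.cons_swap _ _ _)).mono fun y hy => ?_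
        refine back ((h₁.tensor (front hy)).cast (add_left_comm _ _ _) ?_)
        rw [add_left_comm]
  | @prec S₁ S₂ Γ₁ Γ₂ A B C D h₁ h₂ ih₁ ih₂ =>
    obtain ⟨rfl, rfl⟩ | ⟨-, Γ', rfl, h⟩ := Multiset.cons_eq_cons.1 hΘ
    · exact hI _ _ (.prec h₁ h₂)
    obtain ⟨rfl, rfl⟩ | ⟨-, Γ'', h', rfl⟩ := Multiset.cons_eq_cons.1 h
    -- Here `X` is the second of the two principal formulas; the rule is symmetric in them.
    · exact hI _ _ (.prec h₁.swap h₂.swap)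
    · have hX : X ∈ Γ₁ + Γ₂ := h' ▸ Multiset.mem_cons_self _ _
      obtain hX | hX := Multiset.mem_add.1 hX
      · obtain ⟨Γ₁, rfl⟩ := Multiset.exists_cons_of_mem hX
        rw [Multiset.cons_add, Multiset.cons_inj_right] at h'
        subst h'
        refine (ih₁ (Γ := A ::ₘ C ::ₘ Γ₁) ?_).mono fun y hy => ?_
        · rw [Multiset.cons_swap, Multiset.cons_swap X]
        refine ((front₂ hy).prec h₂).cast (add_assoc _ _ _) ?_
        simp [add_assoc]
      · obtain ⟨Γ₂, rfl⟩ := Multiset.exists_cons_of_mem hX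
        rw [Multiset.add_cons, Multiset.cons_inj_right] at h'
        subst h'
        refine (ih₂ (Γ := B ::ₘ D ::ₘ Γ₂) ?_).mono fun y hy => ?_
        · rw [Multiset.cons_swap, Multiset.cons_swap X]
        refine (h₁.prec (front₂ hy)).cast (add_left_comm _ _ _) ?_
        simp [add_left_comm]
  | oplus i h ih =>
    obtain ⟨rfl, rfl⟩ | ⟨-, Γ', rfl, rfl⟩ := Multiset.cons_eq_cons.1 hΘ
    · exact hI _ _ (.oplus i h)
    · exact (ih (Multiset.cons_swap _ _ _)).mono fun y hy => back ((front hy).oplus i)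
  | wth h ih =>
    obtain ⟨rfl, rfl⟩ | ⟨-, Γ', rfl, rfl⟩ := Multiset.cons_eq_cons.1 hΘ
    · exact hI _ _ (.wth h)
    · exact (eventually_all.2 fun i => ih i (Multiset.cons_swap _ _ _)).mono fun y hy =>
        back (.wth fun i => front (hy i))
  | all x hx hxS h ih =>
    obtain ⟨rfl, rfl⟩ | ⟨-, Γ', rfl, rfl⟩ := Multiset.cons_eq_cons.1 hΘ
    · exact hI _ _ (.all x hx hxS h)
    · filter_upwards [ih (Multiset.cons_swap _ _ _), eventually_ne x] with y hy hyx
      exact back (.all x (fresh hyx hx) (store hyx hxS) (front hy))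
  | ex z h ih =>
    obtain ⟨rfl, rfl⟩ | ⟨-, Γ', rfl, rfl⟩ := Multiset.cons_eq_cons.1 hΘ
    · exact hI _ _ (.ex z h)
    · exact (ih (Multiset.cons_swap _ _ _)).mono fun y hy => back ((front hy).ex z)
  | load x hx hxS h ih =>
    obtain ⟨rfl, rfl⟩ | ⟨-, Γ', rfl, rfl⟩ := Multiset.cons_eq_cons.1 hΘ
    · exact hI _ _ (.load x hx hxS h)
    · filter_upwards [ih (Multiset.cons_swap _ _ _), eventually_ne x] with y hy hyx
      exact back (.load x (fresh hyx hx) (store hyx hxS)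
        ((front hy).cast (Multiset.add_cons _ _ _) rfl))
  | pop z h ih =>
    obtain ⟨rfl, rfl⟩ | ⟨-, Γ', rfl, rfl⟩ := Multiset.cons_eq_cons.1 hΘ
    · exact hI _ _ (.pop z h)
    · exact (ih (Multiset.cons_swap _ _ _)).mono fun y hy =>
        back (((front hy).pop z).cast (Multiset.add_cons _ _ _).symm rfl)

/-- Replacement of an occurrence of `X` by formulas without new free variables. -/
theorem replace_const [Infinite V] {X : Form V 0} (Ξ : Multiset (Form V 0))
    (hΞ : ∀ B ∈ Ξ, B.fv ⊆ X.fv) (hI : ∀ S Γ, Intro S X Γ → CDerives S (Ξ + Γ))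
    {S : Multiset V} {Γ : Multiset (Form V 0)} (h : CDerives S (X ::ₘ Γ)) :
    CDerives S (Ξ + Γ) := by
  have := replace (fun _ => 0) (fun _ => Ξ) (by simp)
    (fun y B hB => (hΞ B hB).trans (Set.subset_insert _ _))
    (fun S Γ h => .of_forall fun _ => (hI S Γ h).cast (zero_add S).symm rfl) h
  obtain ⟨_, h'⟩ := this.exists
  simpa using h'

theorem par_inv [Infinite V] {S : Multiset V} {A B : Form V 0} {Γ : Multiset (Form V 0)}
    (h : CDerives S (Form.par A B ::ₘ Γ)) : CDerives S (A ::ₘ B ::ₘ Γ) := by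
  have := replace_const {A, B} (by simp [Form.fv]) (fun S Γ h => by
    cases h with
    | par h => simpa using h) h
  simpa using this

theorem wth_inv [Infinite V] {S : Multiset V} {k : ℕ} {hk : 0 < k} {A : Fin k → Form V 0}
    {Γ : Multiset (Form V 0)} (h : CDerives S (Form.wth k hk A ::ₘ Γ)) (i : Fin k) :
    CDerives S (A i ::ₘ Γ) := by
  have := replace_const {A i}
    (by simpa [Form.fv] using Set.subset_iUnion (fun j => (A j).fv) i) (fun S Γ h => by
    cases h with
    | wth h => simpa using h i) h
  simpa using this

/-- Where `new A` is introduced, equivariance exchanges the loaded eigenvariable for any other fresh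
variable. `replace` carries the new choice down to the conclusion. -/
theorem new_inv {S : Multiset V} {A : Form V 1} {Γ : Multiset (Form V 0)}
    (h : CDerives S (Form.new A ::ₘ Γ)) :
    ∀ᶠ y in cofinite, CDerives (y ::ₘ S) (A.inst y ::ₘ Γ) := by
  classical
  have := replace (fun y => {y}) (fun y => {A.inst y}) (by simp)
    (by simpa [Form.fv] using fun y => Form.fv_inst_subset y A) (fun S Γ h => by
    cases h with
    | load x hx hxS h =>
      filter_upwards [eventually_freshFor (Form.new A ::ₘ Γ), eventually_notMem S] with y hy hyS
      -- Neither `x` nor `y` occurs in `A`, `Γ` or `S`, so the transposition changes only the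
      -- instantiating variable and the loaded one.
      have h' := h.map (Equiv.swap x y)
      have hB : ∀ {n : ℕ} {B : Form V n}, x ∉ B.fv → y ∉ B.fv → B.map (Equiv.swap x y) = B := by
        intro n B hx hy
        rw [Form.map_congr (g := id), Form.map_id]
        intro z hz
        exact Equiv.swap_apply_of_ne_of_ne (fun e => hx (e ▸ hz)) (fun e => hy (e ▸ hz))
      have hΓ : Γ.map (Form.map (Equiv.swap x y)) = Γ := by
        refine (Multiset.map_congr rfl fun B hB' => ?_).trans (Multiset.map_id Γ)
        exact hB (hx B (Multiset.mem_cons_of_mem hB')) (hy B (Multiset.mem_cons_of_mem hB'))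
      have hS : S.map (Equiv.swap x y) = S := by
        refine (Multiset.map_congr rfl fun z hz => ?_).trans (Multiset.map_id S)
        exact Equiv.swap_apply_of_ne_of_ne (fun e => hxS (e ▸ hz)) (fun e => hyS (e ▸ hz))
      rw [freshFor_cons] at hx hy
      rw [Multiset.map_cons, Multiset.map_cons, hS, hΓ, Form.map_inst, Equiv.swap_apply_left,
        hB (B := A) hx.1 hy.1] at h'
      simpa using h') h
  simpa using this

theorem new_of_eventually [Infinite V] {S : Multiset V} {A : Form V 1} {Γ : Multiset (Form V 0)}
    (h : ∀ᶠ y in cofinite, CDerives (y ::ₘ S) (A.inst y ::ₘ Γ)) :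
    CDerives S (Form.new A ::ₘ Γ) := by
  obtain ⟨y, hy, hyΓ, hyS⟩ :=
    (h.and ((eventually_freshFor (Form.new A ::ₘ Γ)).and (eventually_notMem S))).exists
  exact .load y hyΓ hyS hy

/-! ### Identity derivations. -/

/-- Structural induction passes under binders, where indices dangle. Quantifying over all maps `g`
that close the formula makes the hypothesis for a body cover each of its instances. -/
theorem identity_rename [Infinite V] {n : ℕ} (A : Form V n) (g : V ⊕ Fin n → V ⊕ Fin 0) :
    CDerives 0 {(A.rename g).neg, A.rename g} := by
  have rotate : ∀ A B C : Form V 0, C ::ₘ ({A} + {B}) = A ::ₘ B ::ₘ {C} := by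
    intro A B C
    rw [Multiset.singleton_add, Multiset.cons_swap]
    exact congrArg _ (Multiset.pair_comm C B)
  have quant : ∀ {n : ℕ} (A : Form V (n + 1)) (g : V ⊕ Fin n → V ⊕ Fin 0),
      (∀ g : V ⊕ Fin (n + 1) → V ⊕ Fin 0, CDerives 0 {(A.rename g).neg, A.rename g}) →
      ∀ y, CDerives 0 {(A.rename (Form.lift g)).neg.inst y, (A.rename (Form.lift g)).inst y} := by
    intro n A g ih y
    rw [← Form.neg_inst, Form.inst, Form.rename_rename]
    exact ih _
  have atom : ∀ s : V ⊕ Fin 0, ∃ x, s = Sum.inl x := by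
    rintro (x | i)
    · exact ⟨x, rfl⟩
    · exact i.elim0
  induction A with
  | unit => exact (CDerives.unit 0).unitMix
  | send s t =>
    obtain ⟨x, hx⟩ := atom (g s)
    obtain ⟨y, hy⟩ := atom (g t)
    simp only [Form.rename, Form.neg, hx, hy]
    rw [Multiset.pair_comm]
    exact .ax 0 x y
  | recv s t =>
    obtain ⟨x, hx⟩ := atom (g s)
    obtain ⟨y, hy⟩ := atom (g t)
    simp only [Form.rename, Form.neg, hx, hy]
    exact .ax 0 x y
  | par A B hA hB =>
    rw [Multiset.pair_comm]
    refine .par ?_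
    exact ((hA g).tensor (hB g)).cast rfl (rotate _ _ _)
  | tensor A B hA hB =>
    refine .par ?_
    exact ((hA g).swap.tensor (hB g).swap).cast rfl (rotate _ _ _)
  | prec A B hA hB => exact (hA g).prec (hB g)
  | oplus k hk A ih => exact .wth fun i => ((ih i g).swap.oplus i).swap
  | wth k hk A ih =>
    rw [Multiset.pair_comm]
    exact .wth fun i => ((ih i g).oplus i).swap
  | all A ih =>
    obtain ⟨y, hy⟩ := (eventually_freshFor {((Form.all A).rename g), ((Form.all A).rename g).neg}
      ).exists
    rw [Multiset.pair_comm]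
    exact .all y hy (by simp) (((quant A g ih y).ex y).swap)
  | ex A ih =>
    obtain ⟨y, hy⟩ := (eventually_freshFor {((Form.ex A).rename g).neg, ((Form.ex A).rename g)}
      ).exists
    exact .all y hy (by simp) (((quant A g ih y).swap.ex y).swap)
  | new A ih =>
    rw [Multiset.pair_comm]
    exact new_of_eventually (.of_forall fun y => ((quant A g ih y).pop y).swap)
  | ya A ih =>
    exact new_of_eventually (.of_forall fun y => ((quant A g ih y).swap.pop y).swap)

theorem identity [Infinite V] (A : Form V 0) : CDerives 0 {A.neg, A} := by
  simpa only [Form.rename_id] using identity_rename A id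

end CDerives

end

end PiL

open Filter

namespace PiL

/-! ### Entailment in context and monotonicity of the connectives. -/

section

variable {V : Type u}

/-- Under every renaming, if each `A i` is canonically derivable in a context, then so is `B`. -/
def Entails {ι : Type v} (A : ι → Form V 0) (B : Form V 0) : Prop :=
  ∀ (f : V → V) (S : Multiset V) (Γ : Multiset (Form V 0)),
    (∀ i, CDerives S ((A i).map f ::ₘ Γ)) → CDerives S (B.map f ::ₘ Γ)

namespace Entails

variable [Infinite V] {ι : Type v}

theorem par_left {A : ι → Form V 0} {B : Form V 0} (h : Entails A B) (C : Form V 0) :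
    Entails (fun i => Form.par (A i) C) (Form.par B C) := fun f S _ H =>
  .par (h f S _ fun i => CDerives.par_inv (H i))

theorem new [DecidableEq V] [Finite ι] {A : ι → Form V 0} {B : Form V 0} (h : Entails A B)
    (x : V) : Entails (fun i => Form.new ((A i).close x)) (Form.new (B.close x)) := by
  intro f S Γ H
  simp only [Form.map_new] at H ⊢
  -- All premises must be opened with the same variable; finiteness of `ι` provides a common
  -- cofinite set of choices.
  refine .new_of_eventually ((eventually_all.2 fun i => (H i).new_inv).mono fun y hy => ?_)
  simp only [Form.inst_map_close] at hy ⊢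
  exact h _ _ _ hy

end Entails

namespace CDerives

variable [Infinite V]

/-- Since `prec` is not inverted, `A` is exchanged for `B` inside the premise of the rule that
introduces it. The condition `hfv` keeps eigenvariables fresh in the rest of the derivation;
`ex_mono` and `oplus_mono` follow the same pattern. -/
theorem prec_mono {C A B : Form V 0} (hfv : B.fv ⊆ A.fv)
    (h : ∀ S Γ, CDerives S (A ::ₘ Γ) → CDerives S (B ::ₘ Γ))
    {S : Multiset V} {Γ : Multiset (Form V 0)} (H : CDerives S (Form.prec C A ::ₘ Γ)) :
    CDerives S (Form.prec C B ::ₘ Γ) := by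
  refine replace_const {Form.prec C B} ?_ (fun S Γ hI => ?_) H
  · simpa [Form.fv] using hfv.trans Set.subset_union_right
  · cases hI with
    | prec h₁ h₂ => exact h₁.prec (h _ _ h₂)

theorem ex_mono {A B : Form V 1} (hfv : B.fv ⊆ A.fv)
    (h : ∀ y S Γ, CDerives S (A.inst y ::ₘ Γ) → CDerives S (B.inst y ::ₘ Γ))
    {S : Multiset V} {Γ : Multiset (Form V 0)} (H : CDerives S (Form.ex A ::ₘ Γ)) :
    CDerives S (Form.ex B ::ₘ Γ) := by
  refine replace_const {Form.ex B} (by simpa [Form.fv] using hfv) (fun S Γ hI => ?_) H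
  cases hI with
  | ex y h₁ => exact (h y _ _ h₁).ex y

theorem oplus_mono {k : ℕ} {hk : 0 < k} {A B : Fin k → Form V 0}
    (hfv : ∀ i, (B i).fv ⊆ (A i).fv)
    (h : ∀ i S Γ, CDerives S (A i ::ₘ Γ) → CDerives S (B i ::ₘ Γ))
    {S : Multiset V} {Γ : Multiset (Form V 0)} (H : CDerives S (Form.oplus k hk A ::ₘ Γ)) :
    CDerives S (Form.oplus k hk B ::ₘ Γ) := by
  refine replace_const {Form.oplus k hk B} ?_ (fun S Γ hI => ?_) H
  · simpa [Form.fv] using fun i => (hfv i).trans (Set.subset_iUnion (fun j => (A j).fv) i)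
  · cases hI with
    | oplus i h₁ => exact (h i _ _ h₁).oplus i

end CDerives

section Families

variable {Label : Type v} {L : Finset Label} (hL : L.Nonempty)

theorem map_bigWith (f : V → V) {n : ℕ} (A : L → Form V n) :
    (bigWith hL A).map f = bigWith hL (fun l => (A l).map f) := rfl

theorem map_bigOplus (f : V → V) {n : ℕ} (A : L → Form V n) :
    (bigOplus hL A).map f = bigOplus hL (fun l => (A l).map f) := rfl

theorem neg_bigWith {n : ℕ} (A : L → Form V n) :
    (bigWith hL A).neg = bigOplus hL (fun l => (A l).neg) := rfl

theorem fv_bigWith {n : ℕ} (A : L → Form V n) : (bigWith hL A).fv = ⋃ l, (A l).fv :=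
  L.equivFin.symm.surjective.iUnion_comp fun l => (A l).fv

theorem fv_bigOplus {n : ℕ} (A : L → Form V n) : (bigOplus hL A).fv = ⋃ l, (A l).fv :=
  L.equivFin.symm.surjective.iUnion_comp fun l => (A l).fv

theorem CDerives.bigWith {S : Multiset V} {Γ : Multiset (Form V 0)} {A : L → Form V 0}
    (h : ∀ l, CDerives S (A l ::ₘ Γ)) : CDerives S (bigWith hL A ::ₘ Γ) :=
  .wth fun _ => h _

theorem CDerives.bigWith_inv [Infinite V] {S : Multiset V} {Γ : Multiset (Form V 0)}
    {A : L → Form V 0} (h : CDerives S (PiL.bigWith hL A ::ₘ Γ)) (l : L) :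
    CDerives S (A l ::ₘ Γ) := by
  simpa using CDerives.wth_inv h (L.equivFin l)

theorem CDerives.bigOplus {S : Multiset V} {Γ : Multiset (Form V 0)} {A : L → Form V 0} (l : L)
    (h : CDerives S (A l ::ₘ Γ)) : CDerives S (bigOplus hL A ::ₘ Γ) :=
  .oplus (L.equivFin l) (by simpa using h)

end Families

end

/-! ### The translation: free variables, substitution and invariance. -/

namespace Proc

variable {Name : Type u} {Label : Type v} [DecidableEq Name] [DecidableEq Label]

theorem fv_toForm_recv (x y : Name) (P : Proc Name Label) :
    (recv x y P).toForm.fv = {Sum.inl x} ∪ P.toForm.fv \ {Sum.inl y} := by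
  ext z
  simp [toForm, Form.fv, Form.fv_close, eq_comm]

theorem mem_fn_of_mem_fv {P : Proc Name Label} {z : Name} (h : Sum.inl z ∈ P.toForm.fv) :
    z ∈ P.fn := by
  induction P with
  | recv x y P ih =>
    rw [fv_toForm_recv] at h
    rcases h with h | h
    · exact Or.inl (Sum.inl_injective h)
    · exact Or.inr ⟨ih h.1, fun e => h.2 (congrArg Sum.inl e)⟩
  | nu x P ih =>
    simp only [toForm, Form.fv, Form.fv_close] at h
    exact ⟨ih h.1, fun e => h.2 (congrArg Sum.inl e)⟩
  | _ => simp_all [toForm, Form.fv, fn, fv_bigWith, fv_bigOplus, eq_comm]; try grind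

theorem close_update_toForm {a b y : Name} (hya : y ≠ a) (hyb : y ≠ b) (A : Form (Name ⊕ Label) 0) :
    (A.map (Function.update id (Sum.inl b) (Sum.inl a))).close (Sum.inl y) =
      (A.close (Sum.inl y)).map (Function.update id (Sum.inl b) (Sum.inl a)) := by
  refine Form.close_map A (fun z _ => ?_) ?_
  · by_cases hz : z = Sum.inl b
    · subst hz
      simp [hya.symm, hyb.symm]
    · simp [hz]
  · simp [hyb]

theorem map_update_close (a b : Name ⊕ Label) (A : Form (Name ⊕ Label) 0) :
    (A.close b).map (Function.update id b a) = A.close b := by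
  refine (Form.map_congr (g := id) ?_).trans (Form.map_id _)
  intro z hz
  rw [Form.fv_close] at hz
  exact Function.update_of_ne hz.2 _ _

theorem inl_ite (a b x : Name) : (Sum.inl (if x = b then a else x) : Name ⊕ Label) =
    Function.update id (Sum.inl b) (Sum.inl a) (Sum.inl x) := by
  by_cases h : x = b <;> simp [h]

theorem toForm_subst {a b : Name} {P : Proc Name Label} (h : a ∉ P.bn) :
    (P.subst a b).toForm = P.toForm.map (Function.update id (Sum.inl b) (Sum.inl a)) := by
  induction P with
  | nil => rfl
  | send x y P ih => simp [subst, toForm, ih h, inl_ite]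
  | recv x y P ih =>
    simp only [bn, Set.mem_union, Set.mem_singleton_iff, not_or] at h
    -- If the binder is `b`, substitution stops there and closing has already removed `b` from the
    -- formula. Otherwise the binder also differs from `a`, which is not bound, so closing commutes
    -- with the renaming.
    by_cases hy : y = b
    · subst hy
      simp [subst, toForm, inl_ite, map_update_close]
    · simp [subst, toForm, inl_ite, hy, ih h.2, close_update_toForm (Ne.symm h.1) hy]
  | par P Q ihP ihQ =>
    simp only [bn, Set.mem_union, not_or] at h
    simp [subst, toForm, ihP h.1, ihQ h.2]
  | nu x P ih =>
    simp only [bn, Set.mem_union, Set.mem_singleton_iff, not_or] at h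
    by_cases hx : x = b
    · subst hx
      simp [subst, toForm, map_update_close]
    · simp [subst, toForm, hx, ih h.2, close_update_toForm (Ne.symm h.1) hx]
  | lsend x L hL P ih =>
    simp only [bn, Set.mem_iUnion, not_exists] at h
    simp [subst, toForm, map_bigWith, inl_ite, fun l => ih l (h l)]
  | lrecv x L hL P ih =>
    simp only [bn, Set.mem_iUnion, not_exists] at h
    simp [subst, toForm, map_bigOplus, inl_ite, fun l => ih l (h l)]

theorem notMem_fv_toForm {x : Name} {S : Proc Name Label} (hx : x ∉ S.fn) :
    Sum.inl x ∉ S.toForm.fv := fun h => hx (mem_fn_of_mem_fv h)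

/-- This supplies the free-variable conditions of the monotonicity lemmas when a step takes place
under a prefix. -/
theorem PreCong.fv_eq {P P' : Proc Name Label} (h : PreCong P P') :
    P.toForm.fv = P'.toForm.fv := by
  induction h with
  | parComm P Q => exact Set.union_comm _ _
  | parAssoc P Q R => exact Set.union_assoc _ _ _
  | parAssoc' P Q R => exact (Set.union_assoc _ _ _).symm
  | nuComm x y P => simp only [toForm, Form.fv, Form.fv_close, Set.sdiff_sdiff_comm]
  | parNil P => exact Set.union_empty _
  | nuErase x S hx =>
    simp only [toForm, Form.fv, Form.fv_close]
    exact Set.sdiff_singleton_eq_self (notMem_fv_toForm hx)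
  | extrude x P S hx =>
    simp only [toForm, Form.fv, Form.fv_close, Set.union_sdiff_distrib]
    rw [Set.sdiff_singleton_eq_self (notMem_fv_toForm hx)]
  | refl P => rfl
  | trans _ _ ih₁ ih₂ => exact ih₁.trans ih₂
  | send x y _ ih => simp only [toForm, Form.fv, ih]
  | recv x y _ ih => rw [fv_toForm_recv, fv_toForm_recv, ih]
  | par _ _ ih₁ ih₂ => simp only [toForm, Form.fv, ih₁, ih₂]
  | nu x _ ih => simp only [toForm, Form.fv, Form.fv_close, ih]
  | lsend x hL _ ih => simp only [toForm, Form.fv, fv_bigWith, ih]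
  | lrecv x hL _ ih => simp only [toForm, Form.fv, fv_bigOplus, ih]

theorem map_update_toForm (f : Name ⊕ Label → Name ⊕ Label) {x : Name} {S : Proc Name Label}
    (hx : x ∉ S.fn) (y : Name ⊕ Label) :
    S.toForm.map (Function.update f (Sum.inl x) y) = S.toForm.map f :=
  Form.map_congr fun _ hz => Function.update_of_ne
    (fun e => notMem_fv_toForm hx (e ▸ hz)) _ _

/-! ### Structural precongruence and reduction as entailments. -/

variable [Infinite Name]

open CDerives in
theorem PreCong.entails {P P' : Proc Name Label} (h : PreCong P P') :
    Entails (fun _ : Unit => P'.toForm) P.toForm := by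
  have fv_map_subset : ∀ {P P' : Proc Name Label} (f : Name ⊕ Label → Name ⊕ Label),
      PreCong P P' → (P.toForm.map f).fv ⊆ (P'.toForm.map f).fv := by
    intro P P' f h
    rw [Form.fv_map, Form.fv_map, h.fv_eq]
  induction h with
  | parComm P Q => exact fun f S Γ H => .par (H ()).par_inv.swap
  | parAssoc P Q R =>
    intro f S Γ H
    have h := (H ()).par_inv.swap.par_inv
    exact .par (.par (swap (h.cast rfl (congrArg _ (Multiset.cons_swap _ _ _)))))
  | parAssoc' P Q R =>
    intro f S Γ H
    have h := (H ()).par_inv.par_inv.swap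
    exact .par (swap (.par (h.cast rfl (congrArg _ (Multiset.cons_swap _ _ _)))))
  | nuComm x y P =>
    by_cases hxy : x = y
    · subst hxy
      exact fun f S Γ H => H ()
    intro f S Γ H
    simp only [toForm, Form.map_new] at H ⊢
    -- Both restrictions are inverted, with `z` for `y` and then `w` for `x`, and reloaded in the
    -- opposite order. Loading `z` inside requires it to be fresh after `w` has been substituted,
    -- whence `hzP` and `hwz`.
    obtain ⟨z, hz, hzS, hzΓ, hzP⟩ := ((H ()).new_inv.and ((eventually_notMem S).and
      ((eventually_freshFor Γ).and (eventually_notMem_fv (P.toForm.map f))))).exists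
    rw [Form.inst_map_close, Form.map_new] at hz
    obtain ⟨w, hw, hwS, hwΓ, hwz⟩ := (hz.new_inv.and ((eventually_notMem S).and
      ((eventually_freshFor (Form.new (((Form.new (P.toForm.close (Sum.inl y))).close
        (Sum.inl x)).map f) ::ₘ Γ)).and (eventually_ne z)))).exists
    refine .load w (by simpa [toForm] using hwΓ) hwS ?_
    rw [Form.inst_map_close, Form.map_new]
    refine .load z (freshFor_cons.2 ⟨?_, hzΓ⟩) (by simp [hzS, hwz.symm]) ?_
    · rw [← Form.map_new, Form.fv_map]
      rintro ⟨v, hv, hvz⟩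
      by_cases hvx : v = Sum.inl x
      · subst hvx
        exact hwz (by simpa using hvz)
      · rw [Function.update_of_ne hvx] at hvz
        refine hzP (Form.fv_map f _ ▸ ⟨v, ?_, hvz⟩)
        simp only [Form.fv, Form.fv_close] at hv
        exact hv.1
    · rw [Form.inst_map_close] at hw ⊢
      rw [Function.update_comm (by simpa using hxy)]
      exact hw.cast (Multiset.cons_swap _ _ _) rfl
  | parNil P => exact fun f S Γ H => .par (swap (.unitMix (H ())))
  | nuErase x S hx =>
    intro f T Γ H
    simp only [toForm, Form.map_new]
    -- The loaded variable is never popped: axioms accept any store, so it can remain unused. As `x`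
    -- does not occur in `S`, opening the binder changes nothing.
    refine .new_of_eventually ((H ()).weaken.mono fun y hy => ?_)
    rwa [Form.inst_map_close, map_update_toForm f hx]
  | extrude x P S hx =>
    intro f T Γ H
    simp only [toForm, Form.map_new, Form.map_par] at H ⊢
    refine .par (.new_of_eventually ((H ()).new_inv.mono fun y hy => ?_))
    rw [Form.inst_map_close, Form.map_par, map_update_toForm f hx] at hy
    rw [Form.inst_map_close]
    exact hy.par_inv
  | refl P => exact fun f S Γ H => H ()
  | trans _ _ ih₁ ih₂ => exact fun f S Γ H => ih₁ f S Γ fun _ => ih₂ f S Γ H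
  | send x y h ih =>
    exact fun f S Γ H => prec_mono (fv_map_subset f h) (fun S Γ H => ih f S Γ fun _ => H) (H ())
  | @recv x y P P' h ih =>
    intro f S Γ H
    simp only [toForm, Form.map_ex] at H ⊢
    refine ex_mono ?_ (fun z S Γ H => ?_) (H ())
    · have := h.fv_eq
      simp only [Form.fv_map, Form.fv, Form.fv_close, this]
      exact subset_rfl
    · have key : ∀ P : Proc Name Label,
          ((Form.prec (Form.recv (Sum.inl (Sum.inl x)) (Sum.inr 0))
            (P.toForm.close (Sum.inl y))).map f).inst z =
          Form.prec (Form.recv (Sum.inl (f (Sum.inl x))) (Sum.inl z))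
            (P.toForm.map (Function.update f (Sum.inl y) z)) := by
        intro P
        rw [← Form.inst_map_close]
        rfl
      rw [key] at H ⊢
      exact prec_mono (fv_map_subset _ h) (fun S Γ H => ih _ S Γ fun _ => H) H
  | par _ _ ih₁ ih₂ =>
    intro f S Γ H
    -- The two components are exchanged one at a time, each with the other as part of its context.
    exact .par (ih₁ f _ _ fun _ => swap (ih₂ f _ _ fun _ => (H ()).par_inv.swap))
  | nu x _ ih => exact ih.new (Sum.inl x)
  | lsend x hL h ih =>
    intro f S Γ H
    simp only [toForm, map_bigWith, Form.map_prec] at H ⊢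
    refine CDerives.bigWith hL fun l => ?_
    exact prec_mono (fv_map_subset f (h l)) (fun S Γ H => ih l f S Γ fun _ => H)
      (bigWith_inv hL (H ()) l)
  | lrecv x hL h ih =>
    intro f S Γ H
    refine oplus_mono (fun i => ?_) (fun i S Γ H => ?_) (H ())
    · exact Set.union_subset_union_right _ (fv_map_subset f (h _))
    · exact prec_mono (fv_map_subset f (h _)) (fun S Γ H => ih _ f S Γ fun _ => H) H

theorem entails_com {x a b : Name} {P Q : Proc Name Label} (ha : a ∉ Q.bn) :
    Entails (fun _ : Unit => (par P (Q.subst a b)).toForm)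
      (par (send x a P) (recv x b Q)).toForm := by
  intro f S Γ H
  have h := (H ()).par_inv
  simp only [toForm_subst ha] at h
  change CDerives S (P.toForm.map f ::ₘ (Form.map f _) ::ₘ Γ) at h
  rw [Form.map_map] at h
  have hf : f ∘ Function.update id (Sum.inl b) (Sum.inl a) =
      Function.update f (Sum.inl b) (f (Sum.inl a)) := by
    rw [Function.comp_update, Function.comp_id]
  rw [hf, ← Form.inst_map_close] at h
  -- The axiom matches output with input on the left of `prec`, and the given derivation handles the
  -- continuations on the right. The transmitted name is the witness for the input's `∃`.
  have hax := CDerives.ax 0 (f (Sum.inl x)) (f (Sum.inl a))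
  have hp := (hax.prec h).cast (zero_add S) (congrArg _ (congrArg _ (zero_add Γ)))
  simp only [toForm, Form.map_par, Form.map_ex]
  exact .par (.swap (.ex (f (Sum.inl a)) hp.swap))

theorem entails_label {x : Name} {L : Finset Label} (hL : L.Nonempty) {P : Proc Name Label}
    {Q : L → Proc Name Label} (k : L) :
    Entails (fun _ : Unit => (par P (Q k)).toForm)
      (par (lsend x {k.1} (Finset.singleton_nonempty k.1) (fun _ => P))
        (lrecv x L hL Q)).toForm := by
  intro f S Γ H
  have h := (H ()).par_inv
  have hax := CDerives.ax 0 (f (Sum.inl x)) (f (Sum.inr k.1))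
  have hp := (hax.prec h).cast (zero_add S) (congrArg _ (congrArg _ (zero_add Γ)))
  simp only [toForm, Form.map_par, map_bigWith, map_bigOplus, Form.map_prec]
  refine .par (.bigWith _ fun l => .swap (.bigOplus hL k ?_))
  have hl : l.1 = k.1 := Finset.mem_singleton.1 l.2
  simp only [hl]
  exact hp.swap

theorem entails_choice {x : Name} {L : Finset Label} (hL : L.Nonempty)
    (P : L → Proc Name Label) :
    Entails (fun k : L => (lsend x {k.1} (Finset.singleton_nonempty k.1) (fun _ => P k)).toForm)
      (lsend x L hL P).toForm := by
  intro f S Γ H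
  simp only [toForm, map_bigWith] at H ⊢
  -- The `k`-th reduct is a `&` over one label, whose only component is the `k`-th component of the
  -- original `&`.
  exact .bigWith hL fun k => CDerives.bigWith_inv _ (H k) ⟨k.1, Finset.mem_singleton_self k.1⟩

/-- For a choice, the alternatives of the core are carried through the reduction context. They are
kept with the same last rule `r`, because the structural rule can be reapplied to each only if that
rule is not structural. -/
theorem Red.entails {r c : Rule} {P P' : Proc Name Label} (h : Red r c P P') :
    ((c = Rule.com ∨ c = Rule.label) ∧ Entails (fun _ : Unit => P'.toForm) P.toForm) ∨
    (c = Rule.choice ∧ ∃ (L : Finset Label) (_ : L.Nonempty) (F : L → Proc Name Label),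
      P' ∈ Set.range F ∧ (∀ l, Red r Rule.choice P (F l)) ∧
      Entails (fun l => (F l).toForm) P.toForm) := by
  induction h with
  | com x a b P Q ha => exact Or.inl ⟨Or.inl rfl, entails_com ha⟩
  | choice x L hL P k =>
    exact Or.inr ⟨rfl, L, hL, _, ⟨k, rfl⟩, fun l => .choice x L hL P l, entails_choice hL P⟩
  | label x L hL P Q k => exact Or.inl ⟨Or.inr rfl, entails_label hL k⟩
  | res x _ ih =>
    obtain ⟨hc, h⟩ | ⟨hc, L, hL, F, ⟨k, rfl⟩, hF, h⟩ := ih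
    · exact Or.inl ⟨hc, h.new (Sum.inl x)⟩
    · exact Or.inr ⟨hc, L, hL, fun l => .nu x (F l), ⟨k, rfl⟩, fun l => .res x (hF l),
        h.new (Sum.inl x)⟩
  | par Q _ ih =>
    obtain ⟨hc, h⟩ | ⟨hc, L, hL, F, ⟨k, rfl⟩, hF, h⟩ := ih
    · exact Or.inl ⟨hc, h.par_left Q.toForm⟩
    · exact Or.inr ⟨hc, L, hL, fun l => .par (F l) Q, ⟨k, rfl⟩, fun l => .par Q (hF l),
        h.par_left Q.toForm⟩
  | struc hP hne _ hr ih =>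
    obtain ⟨hc, h⟩ | ⟨hc, L, hL, F, hk, hF, h⟩ := ih
    · exact Or.inl ⟨hc, fun f S Γ H => hP.entails f S Γ fun _ => h f S Γ H⟩
    · exact Or.inr ⟨hc, L, hL, F, hk, fun l => .struc hP hne (hF l) hr,
        fun f S Γ H => hP.entails f S Γ fun _ => h f S Γ H⟩

end Proc

/-! ### From entailment to provable implication. -/

theorem provable_limp_of_cDerives {V : Type u} {A B : Form V 0} (h : CDerives 0 {A.neg, B}) :
    Provable (A.limp B) :=
  CDerives.derives (S := 0) (.par h) Multiset.nodup_zero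

theorem Entails.provable {V : Type u} [Infinite V] {A B : Form V 0}
    (h : Entails (fun _ : Unit => A) B) : Provable (A.limp B) := by
  -- Taking the context to be `A.neg` makes the premise an identity derivation and the conclusion
  -- the desired implication.
  have := h id 0 {A.neg} fun _ => by
    rw [Form.map_id]
    exact (CDerives.identity A).swap
  rw [Form.map_id] at this
  exact provable_limp_of_cDerives this.swap

theorem Entails.provable_bigWith {V : Type u} [Infinite V] {Label : Type v} {L : Finset Label}
    (hL : L.Nonempty) {A : L → Form V 0} {B : Form V 0} (h : Entails A B) :
    Provable ((bigWith hL A).limp B) := by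
  have := h id 0 {(bigWith hL A).neg} fun l => by
    rw [Form.map_id, neg_bigWith]
    exact (CDerives.bigOplus hL l (CDerives.identity (A l))).swap
  rw [Form.map_id] at this
  exact provable_limp_of_cDerives this.swap

end PiL

theorem mainTheorem5 {Name : Type*} {Label : Type*} [DecidableEq Name] [DecidableEq Label]
    [Infinite Name] (P P' : PiL.Proc Name Label) :
    (PiL.Proc.PreCong P P' → PiL.Provable (PiL.Form.limp P'.toForm P.toForm)) ∧
    (∀ core : PiL.Proc.Rule, PiL.Proc.ReducesBy core P P' →
      ((core = PiL.Proc.Rule.com ∨ core = PiL.Proc.Rule.label) ∧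
        PiL.Provable (PiL.Form.limp P'.toForm P.toForm)) ∨
      (core = PiL.Proc.Rule.choice ∧
        ∃ (L : Finset Label) (hL : L.Nonempty) (F : L → PiL.Proc Name Label),
          P' ∈ Set.range F ∧ (∀ l, PiL.Proc.Reduces P (F l)) ∧
          PiL.Provable
            (PiL.Form.limp (PiL.bigWith hL (fun l => (F l).toForm)) P.toForm))) := by
  refine ⟨fun h => h.entails.provable, ?_⟩
  rintro core ⟨last, h⟩
  obtain ⟨hc, h⟩ | ⟨hc, L, hL, F, hk, hF, h⟩ := h.entails
  · exact Or.inl ⟨hc, h.provable⟩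
  · exact Or.inr ⟨hc, L, hL, F, hk, fun l => ⟨_, _, hF l⟩, h.provable_bigWith hL⟩
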